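/- Let $p$ be a prime, let $G$ be a finite $p$-solvable group, that is, $G$ has a series $1=H_0\le H_1\le\cdots\le H_n=G$ of normal subgroups of $G$ such that the order of each factor $H_{i+1}/H_i$ is either a power of $p$ or prime to $p$, and let $P$ be a Sylow $p$-subgroup of $G$. Let $N$ be a normal subgroup of $P$ that is powerfully embedded in $P$, that is, $[N,P]\le N^{2p}$, where $N^{2p}$ is the subgroup generated by the $2p$-th powers of the elements of $N$. Then $N\subseteq O_{p'p}(G)$. Here $O_{p'}(G)$ is the largest normal subgroup of $G$ of order prime to $p$, and $O_{p'p}(G)$ is the full preimage in $G$ of the largest normal $p$-subgroup $O_p(G/O_{p'}(G))$ of $G/O_{p'}(G)$. -/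

import Mathlib

/-- `G` is `p`-solvable: it has a finite series `1 = H 0 ≤ H 1 ≤ ⋯ ≤ H n = G` of normal subgroups
of `G`, the order of each factor `H (i + 1) / H i` (which is `(H i).relIndex (H (i + 1))`) being
a power of `p` or prime to `p`. -/
def IsPSolvableGroup (p : ℕ) (G : Type*) [Group G] : Prop :=
  ∃ (n : ℕ) (H : ℕ → Subgroup G), H 0 = ⊥ ∧ H n = ⊤ ∧
    (∀ i, (H i).Normal) ∧
    ∀ i < n, H i ≤ H (i + 1) ∧
      ((∃ k : ℕ, (H i).relIndex (H (i + 1)) = p ^ k) ∨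
        ((H i).relIndex (H (i + 1))).Coprime p)

/-- `O_p(G)`, the largest normal `p`-subgroup of the finite group `G`:
the subgroup generated by all normal `p`-subgroups. -/
def pCore (p : ℕ) (G : Type*) [Group G] : Subgroup G :=
  sSup {H : Subgroup G | H.Normal ∧ IsPGroup p H}

/-- `O_{p'}(G)`, the largest normal subgroup of order prime to `p` of the finite group `G`:
the subgroup generated by all normal subgroups of order prime to `p`. -/
def pPrimeCore (p : ℕ) (G : Type*) [Group G] : Subgroup G :=
  sSup {H : Subgroup G | H.Normal ∧ (Nat.card H).Coprime p}

instance pPrimeCore_normal (p : ℕ) (G : Type*) [Group G] : (pPrimeCore p G).Normal := by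
  unfold pPrimeCore
  rw [sSup_eq_iSup']
  have : ∀ H : {H : Subgroup G | H.Normal ∧ (Nat.card H).Coprime p},
      (H : Subgroup G).Normal := fun H => H.2.1
  exact Subgroup.iSup_normal _

/-- `O_{p'p}(G)`, the full preimage of `O_p(G / O_{p'}(G))` in `G`. -/
def pPrimePCore (p : ℕ) (G : Type*) [Group G] : Subgroup G :=
  (pCore p (G ⧸ pPrimeCore p G)).comap (QuotientGroup.mk' (pPrimeCore p G))

/-- `N ^ n`, the subgroup generated by the `n`-th powers of the elements of `N`. -/
def powerSubgroup {P : Type*} [Group P] (N : Subgroup P) (n : ℕ) : Subgroup P :=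
  Subgroup.closure {y : P | ∃ x ∈ N, y = x ^ n}

/-- `N` is powerfully embedded in the finite `p`-group `P`: `N` is normal in `P` and
`[N, P] ≤ N ^ (2 p)`. For odd `p` one has `N ^ (2 p) = N ^ p`; for `p = 2` it is `N ^ 4`. -/
structure IsPowerfullyEmbedded (p : ℕ) {P : Type*} [Group P] (N : Subgroup P) : Prop where
  normal : N.Normal
  commutator_le : ⁅N, (⊤ : Subgroup P)⁆ ≤ powerSubgroup N (2 * p)

/-! ### Powers and powerful embedding in `p`-groups. -/

open scoped commutatorElement

/-! Modulo `O_{p'}(G)` one may assume `O_{p'}(G) = 1`; put `V = O_p(G)`. By Hall–Higman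
(`centralizer_pCore_le`) `C_G(V) ≤ V`, so `N ≤ V` if `N` is central in `P`.

Otherwise let `M` be a minimal noncentral powerfully embedded subgroup of `P`. Then `M ^ (2p)` is
powerfully embedded and proper in `M`, hence central, and it is nontrivial since it contains `[M, P]
≠ 1`. This yields `x` with `[x, P] ≤ Z(P)` and a power `x ^ n`, `2p ∣ n`, of order `p` in `Z(P)`.
Its normal closure `A` in `G` is an elementary abelian subgroup of `Z(V)`.

The heart is `O_{p'}(G / A) = 1` (`pPrimeCore_quotient_normalClosure`). Let `L / A = O_{p'}(G / A)`
and let `K` be a complement of `A` in `L`. Complements are conjugate, so some `a * x` with `a ∈ A`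
normalizes `K`, and `(a * x) ^ n = x ^ n`. Thus `[x ^ n, K] ≤ A ∩ K = 1`, so `A` is central in `L`,
and `K` is a normal `p'`-subgroup of `G`, hence trivial. Induction on `|G|` applies to `G / A`, and
the preimage of `O_p(G / A)` is a normal `p`-group. -/

theorem mul_pow_of_central_commutator {G : Type*} [Group G] {a x d : G}
    (h : x * a = d * a * x) (hda : Commute d a) (hdx : Commute d x) (n : ℕ) :
    (a * x) ^ n = a ^ n * x ^ n * d ^ n.choose 2 := by
  have hpow : ∀ m : ℕ, x ^ m * a = d ^ m * a * x ^ m := by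
    intro m
    induction m with
    | zero => simp
    | succ m ih =>
      calc x ^ (m + 1) * a = x ^ m * (x * a) := by rw [pow_succ, mul_assoc]
        _ = x ^ m * d * a * x := by rw [h]; group
        _ = d * (x ^ m * a) * x := by rw [← (hdx.pow_right m).eq]; group
        _ = d ^ (m + 1) * a * x ^ (m + 1) := by rw [ih, pow_succ' d, pow_succ x]; group
  induction n with
  | zero => simp
  | succ n ih =>
    have hc : Commute (d ^ n.choose 2) (a * x) := (hda.mul_right hdx).pow_left _
    have hd : Commute (d ^ n) (a ^ n * a * x ^ n * x) :=
      ((((hda.pow_right n).mul_right hda).mul_right (hdx.pow_right n)).mul_right hdx).pow_left n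
    calc (a * x) ^ (n + 1) = a ^ n * x ^ n * (d ^ n.choose 2 * (a * x)) := by
          rw [pow_succ, ih, mul_assoc]
      _ = a ^ n * (x ^ n * a) * x * d ^ n.choose 2 := by rw [hc.eq]; group
      _ = (a ^ n * d ^ n) * a * x ^ n * x * d ^ n.choose 2 := by rw [hpow n]; group
      _ = d ^ n * (a ^ n * a * x ^ n * x) * d ^ n.choose 2 := by
          rw [← ((hda.pow_left n).pow_right n).eq]; group
      _ = a ^ (n + 1) * x ^ (n + 1) * d ^ (n + 1).choose 2 := by
          rw [hd.eq, Nat.choose_succ_succ' n 1, Nat.choose_one_right, pow_add d, pow_succ a,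
            pow_succ x]
          group

theorem pow_mem_powerSubgroup {P : Type*} [Group P] {N : Subgroup P} {x : P} (hx : x ∈ N) (n : ℕ) :
    x ^ n ∈ powerSubgroup N n :=
  Subgroup.subset_closure ⟨x, hx, rfl⟩

theorem powerSubgroup_le_iff {P : Type*} [Group P] {N K : Subgroup P} {n : ℕ} :
    powerSubgroup N n ≤ K ↔ ∀ x ∈ N, x ^ n ∈ K := by
  rw [powerSubgroup, Subgroup.closure_le]
  exact ⟨fun h x hx => h ⟨x, hx, rfl⟩, fun h _ ⟨x, hx, e⟩ => e ▸ h x hx⟩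

theorem powerSubgroup_le {P : Type*} [Group P] (N : Subgroup P) (n : ℕ) : powerSubgroup N n ≤ N :=
  powerSubgroup_le_iff.2 fun _ hx => N.pow_mem hx n

theorem map_powerSubgroup {P Q : Type*} [Group P] [Group Q] (f : P →* Q) (N : Subgroup P) (n : ℕ) :
    (powerSubgroup N n).map f = powerSubgroup (N.map f) n := by
  apply le_antisymm
  · rw [Subgroup.map_le_iff_le_comap, powerSubgroup_le_iff]
    intro x hx
    rw [Subgroup.mem_comap, map_pow]
    exact pow_mem_powerSubgroup (Subgroup.mem_map_of_mem f hx) n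
  · rw [powerSubgroup_le_iff]
    rintro _ ⟨x, hx, rfl⟩
    rw [← map_pow]
    exact Subgroup.mem_map_of_mem f (pow_mem_powerSubgroup hx n)

theorem powerSubgroup_normal {P : Type*} [Group P] {N : Subgroup P} (hN : N.Normal) (n : ℕ) :
    (powerSubgroup N n).Normal := by
  refine ⟨fun y hy g => ?_⟩
  have h : powerSubgroup N n ≤ (powerSubgroup N n).comap (MulAut.conj g).toMonoidHom := by
    rw [powerSubgroup_le_iff]
    intro x hx
    rw [Subgroup.mem_comap, map_pow]
    exact pow_mem_powerSubgroup (hN.conj_mem x hx g) n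
  exact h hy

theorem IsPGroup.eq_one_of_pow_eq_one_of_coprime {p : ℕ} {G : Type*} [Group G] (hG : IsPGroup p G)
    {x : G} {n : ℕ} (hn : p.Coprime n) (hx : x ^ n = 1) : x = 1 := by
  have h := hG.orderOf_coprime hn x
  exact orderOf_eq_one_iff.1 (Nat.Coprime.eq_one_of_dvd h (orderOf_dvd_of_pow_eq_one hx))

theorem choose_two_mul_prime (p : ℕ) : (2 * p).choose 2 = p * (2 * p - 1) := by
  rw [Nat.choose_two_right, mul_assoc, Nat.mul_div_cancel_left _ two_pos]

/-- In the last step of a central series, `[N, P] ≤ N ^ (2p)` makes `N ^ (2p)` central. -/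
theorem powerSubgroup_le_center_of_commutator_le {p : ℕ} (hp : p.Prime) {P : Type*} [Group P]
    (hP : IsPGroup p P) {N : Subgroup P} (hN : IsPowerfullyEmbedded p N)
    (hexp : ∀ c ∈ powerSubgroup N (2 * p), c ^ (2 * p) = 1)
    (hcen : ∀ c ∈ powerSubgroup N (2 * p), ∀ g : P, ⁅g, c⁆ ∈ Subgroup.center P) :
    powerSubgroup N (2 * p) ≤ Subgroup.center P := by
  set M := powerSubgroup N (2 * p) with hM
  have hMn : M.Normal := powerSubgroup_normal hN.normal _
  have hcomm : ∀ x ∈ N, ∀ g : P, ⁅g, x⁆ ∈ M := fun x hx g =>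
    hN.commutator_le (Subgroup.commutator_comm N ⊤ ▸
      Subgroup.commutator_mem_commutator (Subgroup.mem_top g) hx)
  -- Expand `g x ^ (2p) g⁻¹ = ([g, x] x) ^ (2p)`; the factor `[g, x] ^ (2p)` is trivial by `hexp`.
  have key : ∀ x ∈ N, ∀ g : P, ⁅g, x ^ (2 * p)⁆ = ⁅x, ⁅g, x⁆⁆ ^ (p * (2 * p - 1)) := by
    intro x hx g
    have hc := hcomm x hx g
    have hd := hcen _ hc x
    rw [Subgroup.mem_center_iff] at hd
    have h := mul_pow_of_central_commutator (a := ⁅g, x⁆) (x := x) (d := ⁅x, ⁅g, x⁆⁆)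
      (by simp only [commutatorElement_def]; group) (hd _).symm (hd _).symm (2 * p)
    have e : ⁅g, x⁆ * x = g * x * g⁻¹ := by simp only [commutatorElement_def]; group
    rw [e, conj_pow, hexp _ hc, one_mul, choose_two_mul_prime] at h
    have h2 := hd (x ^ (2 * p))
    rw [commutatorElement_def g, h, (Commute.pow_right (h2 : Commute _ _) _).eq,
      mul_inv_cancel_right]
  -- On generators this follows from `key`; it extends to `M` because `m ↦ [g, m]` has central
  -- values and so is multiplicative there.
  have sq_one : ∀ m ∈ M, ∀ g : P, ⁅g, m⁆ ^ 2 = 1 := by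
    intro m hm g
    have hsub : M ≤ Subgroup.closure {y : P | ∃ x ∈ N, y = x ^ (2 * p)} := le_rfl
    refine Subgroup.closure_induction
      (p := fun m _ => ⁅g, m⁆ ^ 2 = 1) ?_ (by simp) ?_ ?_ (hsub hm)
    · rintro _ ⟨x, hx, rfl⟩
      have hdM : ⁅x, ⁅g, x⁆⁆ ∈ M := by
        have := Subgroup.commutator_mem_commutator (Subgroup.mem_top x) (hcomm x hx g)
        exact Subgroup.commutator_le_right ⊤ M this
      rw [key x hx g, ← pow_mul, show p * (2 * p - 1) * 2 = 2 * p * (2 * p - 1) by ring, pow_mul,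
        hexp _ hdM, one_pow]
    · intro a b ha hb iha ihb
      have h1 := Subgroup.mem_center_iff.1 (hcen b hb g)
      rw [commutatorElement_mul_right_eq_mul_conj, mul_assoc ⁅g, a⁆, h1 a, ← mul_assoc,
        mul_inv_cancel_right, Commute.mul_pow (h1 _), iha, ihb, one_mul]
    · intro a ha iha
      have h1 := Subgroup.mem_center_iff.1 (hcen a ha g)
      rw [commutatorElement_inv_right, ← commutatorElement_inv, mul_assoc,
        ← (Commute.inv_right (h1 a : Commute _ _)).eq, inv_mul_cancel_left, inv_pow, iha, inv_one]
  rw [powerSubgroup_le_iff]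
  intro x hx
  rw [Subgroup.mem_center_iff]
  intro g
  rw [← commutatorElement_eq_one_iff_mul_comm, key x hx g]
  have hd2 := sq_one _ (hcomm x hx g) x
  rcases hp.eq_two_or_odd' with rfl | hodd
  · rw [pow_mul, hd2, one_pow]
  · rw [hP.eq_one_of_pow_eq_one_of_coprime (Nat.coprime_two_right.2 hodd) hd2, one_pow]

theorem IsPowerfullyEmbedded.map {p : ℕ} {P Q : Type*} [Group P] [Group Q] {f : P →* Q}
    (hf : Function.Surjective f) {N : Subgroup P} (hN : IsPowerfullyEmbedded p N) :
    IsPowerfullyEmbedded p (N.map f) := by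
  refine ⟨hN.normal.map f hf, ?_⟩
  rw [← map_powerSubgroup, ← Subgroup.map_top_of_surjective f hf, ← Subgroup.map_commutator]
  exact Subgroup.map_mono hN.commutator_le

theorem eq_bot_of_le_commutator_top {G : Type*} [Group G] [Group.IsNilpotent G] {X : Subgroup G}
    (h : X ≤ ⁅X, (⊤ : Subgroup G)⁆) : X = ⊥ := by
  obtain ⟨n, hn⟩ := Subgroup.nilpotent_iff_lowerCentralSeries.1 ‹Group.IsNilpotent G›
  have : ∀ n, X ≤ (⊤ : Subgroup G).lowerCentralSeries n := by
    intro n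
    induction n with
    | zero => exact le_top
    | succ n ih => exact h.trans (Subgroup.commutator_mono ih le_rfl)
  exact le_bot_iff.1 (hn ▸ this n)

/-- With `X = [M, P]` and `Y = M ^ (2p)`, the preceding centrality result modulo `Y[X, P]` gives `X
≤ Y[X, P]`; nilpotency of `P / Y` then forces `X ≤ Y`. -/
theorem IsPowerfullyEmbedded.powerSubgroup {p : ℕ} [Fact p.Prime] {P : Type*} [Group P] [Finite P]
    (hP : IsPGroup p P) {N : Subgroup P} (hN : IsPowerfullyEmbedded p N) :
    IsPowerfullyEmbedded p (powerSubgroup N (2 * p)) := by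
  set M := _root_.powerSubgroup N (2 * p) with hM
  have hMn : M.Normal := powerSubgroup_normal hN.normal _
  refine ⟨hMn, ?_⟩
  set Y := _root_.powerSubgroup M (2 * p) with hY
  have hYn : Y.Normal := powerSubgroup_normal hMn _
  set X := ⁅M, (⊤ : Subgroup P)⁆ with hX
  have step : X ≤ Y ⊔ ⁅X, (⊤ : Subgroup P)⁆ := by
    set R := Y ⊔ ⁅X, (⊤ : Subgroup P)⁆ with hR
    let f := QuotientGroup.mk' R
    have hf : Function.Surjective f := QuotientGroup.mk'_surjective R
    have hle := powerSubgroup_le_center_of_commutator_le (Fact.out : p.Prime)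
      (hP.to_quotient R) (hN.map hf)
      (by
        rw [← map_powerSubgroup]
        rintro _ ⟨c, hc, rfl⟩
        rw [← map_pow]
        exact (QuotientGroup.eq_one_iff _).2 ((le_sup_left : Y ≤ R) (pow_mem_powerSubgroup hc _)))
      (by
        rw [← map_powerSubgroup]
        rintro _ ⟨c, hc, rfl⟩ g
        obtain ⟨g, rfl⟩ := hf g
        rw [Subgroup.mem_center_iff]
        intro k
        obtain ⟨k, rfl⟩ := hf k
        rw [← commutatorElement_eq_one_iff_mul_comm, ← map_commutatorElement,
          ← map_commutatorElement]
        refine (QuotientGroup.eq_one_iff _).2 ((le_sup_right : ⁅X, (⊤ : Subgroup P)⁆ ≤ R) ?_)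
        rw [Subgroup.commutator_comm]
        refine Subgroup.commutator_mem_commutator (Subgroup.mem_top _) ?_
        rw [hX, Subgroup.commutator_comm]
        exact Subgroup.commutator_mem_commutator (Subgroup.mem_top _) hc)
    rw [← map_powerSubgroup] at hle
    rw [hX, Subgroup.commutator_le]
    intro m hm g _
    rw [← QuotientGroup.eq_one_iff (N := R)]
    change f ⁅m, g⁆ = 1
    rw [map_commutatorElement, commutatorElement_eq_one_iff_mul_comm]
    exact (Subgroup.mem_center_iff.1 (hle (Subgroup.mem_map_of_mem f hm)) _).symm
  let f := QuotientGroup.mk' Y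
  have hf : Function.Surjective f := QuotientGroup.mk'_surjective Y
  have hfY : Y.map f = ⊥ := by rw [Subgroup.map_eq_bot_iff, QuotientGroup.ker_mk']
  have : Group.IsNilpotent (P ⧸ Y) := (hP.to_quotient Y).isNilpotent
  have hXb : X.map f = ⊥ := by
    apply eq_bot_of_le_commutator_top
    rw [← Subgroup.map_top_of_surjective f hf, ← Subgroup.map_commutator]
    calc X.map f ≤ (Y ⊔ ⁅X, (⊤ : Subgroup P)⁆).map f := Subgroup.map_mono step
      _ = _ := by rw [Subgroup.map_sup, hfY, bot_sup_eq]
  rwa [Subgroup.map_eq_bot_iff, QuotientGroup.ker_mk'] at hXb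

/-- A nontrivial `p`-group has a normal subgroup of index `p`, which contains every `p`-th power. -/
theorem powerSubgroup_ne_self {p : ℕ} [Fact p.Prime] {P : Type*} [Group P] [Finite P]
    (hP : IsPGroup p P) {M : Subgroup P} (hM : M ≠ ⊥) (k : ℕ) :
    powerSubgroup M (k * p) ≠ M := by
  intro h
  have hMp := hP.to_subgroup M
  have : Nontrivial M := (Subgroup.nontrivial_iff_ne_bot M).2 hM
  obtain ⟨n, hn, hcard⟩ := hMp.nontrivial_iff_card.1 this
  obtain ⟨H, hH⟩ := Sylow.exists_subgroup_card_pow_prime (G := M) p (n := n - 1)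
    (by rw [hcard]; exact pow_dvd_pow p (Nat.sub_le n 1))
  have hp : p.Prime := Fact.out
  have hidx : H.index = p := by
    have := H.card_mul_index
    rw [hH, hcard] at this
    obtain ⟨m, rfl⟩ : ∃ m, n = m + 1 := ⟨n - 1, by omega⟩
    rw [Nat.add_sub_cancel, pow_succ] at this
    exact Nat.eq_of_mul_eq_mul_left (pow_pos hp.pos m) this
  have hHn : H.Normal := Subgroup.normal_of_index_eq_minFac_card
    (by rw [hidx, hcard, hp.pow_minFac hn.ne'])
  have hle : powerSubgroup M (k * p) ≤ H.map M.subtype := by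
    rw [powerSubgroup_le_iff]
    intro x hx
    refine ⟨⟨x, hx⟩ ^ (k * p), ?_, rfl⟩
    rw [mul_comm, pow_mul]
    refine H.pow_mem ?_ k
    rw [← hidx]
    exact H.pow_index_mem _
  rw [h] at hle
  have htop : H = ⊤ := by
    rw [eq_top_iff]
    intro x _
    obtain ⟨y, hy, e⟩ := hle x.2
    rwa [← Subtype.ext e]
  rw [htop, Subgroup.index_top] at hidx
  exact hp.one_lt.ne hidx

theorem IsPowerfullyEmbedded.exists_pow_mem_center {p : ℕ} [Fact p.Prime] {P : Type*} [Group P]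
    [Finite P] (hP : IsPGroup p P) {N : Subgroup P} (hN : IsPowerfullyEmbedded p N)
    (hc : ¬ N ≤ Subgroup.center P) :
    ∃ (x : P) (n : ℕ), 2 * p ∣ n ∧ (∀ g : P, ⁅x, g⁆ ∈ Subgroup.center P) ∧
      x ^ n ∈ Subgroup.center P ∧ x ^ n ≠ 1 ∧ (x ^ n) ^ p = 1 := by
  obtain ⟨M, ⟨hM, hMc⟩, hmin⟩ := (Set.toFinite
    {M : Subgroup P | IsPowerfullyEmbedded p M ∧ ¬ M ≤ Subgroup.center P}).exists_minimal
    ⟨N, hN, hc⟩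
  have hMb : M ≠ ⊥ := by rintro rfl; exact hMc bot_le
  have hT : _root_.powerSubgroup M (2 * p) ≤ Subgroup.center P := by
    by_contra hT
    exact powerSubgroup_ne_self hP hMb 2 (le_antisymm (powerSubgroup_le _ _)
      (hmin ⟨hM.powerSubgroup hP, hT⟩ (powerSubgroup_le _ _)))
  have hTb : ¬ _root_.powerSubgroup M (2 * p) ≤ ⊥ := by
    intro hTb
    have := hM.commutator_le.trans hTb
    rw [le_bot_iff, Subgroup.commutator_top_right_eq_bot_iff_le_center] at this
    exact hMc this
  rw [powerSubgroup_le_iff] at hTb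
  push Not at hTb
  obtain ⟨x, hx, hx1⟩ := hTb
  rw [Subgroup.mem_bot] at hx1
  obtain ⟨k, hk⟩ := IsPGroup.iff_orderOf.1 hP (x ^ (2 * p))
  obtain ⟨j, rfl⟩ : ∃ j, k = j + 1 := by
    refine ⟨k - 1, (Nat.succ_pred_eq_of_ne_zero ?_).symm⟩
    rintro rfl
    exact hx1 (orderOf_eq_one_iff.1 (by simpa using hk))
  have hxc : x ^ (2 * p) ∈ Subgroup.center P := hT (pow_mem_powerSubgroup hx _)
  refine ⟨x, 2 * p * p ^ j, dvd_mul_right _ _, fun g => hT (hM.commutator_le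
    (Subgroup.commutator_mem_commutator hx (Subgroup.mem_top g))), ?_, ?_, ?_⟩
  · rw [pow_mul]
    exact Subgroup.pow_mem _ hxc _
  · rw [pow_mul]
    intro h
    have := orderOf_dvd_of_pow_eq_one h
    rw [hk, Nat.pow_dvd_pow_iff_le_right (Fact.out : p.Prime).one_lt] at this
    omega
  · rw [pow_mul, ← pow_mul, ← pow_succ, ← hk, pow_orderOf_eq_one]

/-! ### Cores, quotients and the Hall–Higman lemma. -/

theorem card_pPrimeCore_coprime (p : ℕ) (G : Type*) [Group G] [Finite G] :
    (Nat.card (pPrimeCore p G)).Coprime p := by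
  obtain ⟨M, ⟨hMn, hM⟩, hmax⟩ := (Set.toFinite
    {H : Subgroup G | H.Normal ∧ (Nat.card H).Coprime p}).exists_maximal
    ⟨⊥, inferInstance, by simp⟩
  have h : pPrimeCore p G = M := by
    refine le_antisymm (sSup_le ?_) (le_sSup ⟨hMn, hM⟩)
    rintro H ⟨hHn, hH⟩
    refine le_sup_right.trans (hmax ⟨Subgroup.sup_normal M H, ?_⟩ le_sup_left)
    rw [← Subgroup.relIndex_bot_left, ← Subgroup.relIndex_mul_relIndex ⊥ M (M ⊔ H) bot_le
      le_sup_left, Subgroup.relIndex_bot_left, Subgroup.relIndex_sup_left]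
    exact Nat.Coprime.mul_left hM (hH.coprime_dvd_left (Subgroup.relIndex_dvd_card _ _))
  rwa [h]

theorem le_pPrimeCore {p : ℕ} {G : Type*} [Group G] {H : Subgroup G} (hn : H.Normal)
    (h : (Nat.card H).Coprime p) : H ≤ pPrimeCore p G :=
  le_sSup ⟨hn, h⟩

theorem le_pCore {p : ℕ} {G : Type*} [Group G] {H : Subgroup G} (hn : H.Normal)
    (h : IsPGroup p H) : H ≤ pCore p G :=
  le_sSup ⟨hn, h⟩

theorem isPGroup_pCore (p : ℕ) [Fact p.Prime] (G : Type*) [Group G] :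
    IsPGroup p (pCore p G) :=
  Sylow.sSup_of_normal _ (fun _ h => h.2) (fun _ h => h.1)

theorem pCore_normal (p : ℕ) (G : Type*) [Group G] : (pCore p G).Normal := by
  rw [pCore, sSup_eq_iSup']
  have (H : {H : Subgroup G | H.Normal ∧ IsPGroup p H}) : (H : Subgroup G).Normal := H.2.1
  exact Subgroup.iSup_normal _

theorem le_comap_mk' {G : Type*} [Group G] (A : Subgroup G) [A.Normal] (K : Subgroup (G ⧸ A)) :
    A ≤ K.comap (QuotientGroup.mk' A) := fun x hx => by
  rw [Subgroup.mem_comap, QuotientGroup.mk'_apply, (QuotientGroup.eq_one_iff x).2 hx]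
  exact one_mem _

theorem relIndex_comap_mk' {G : Type*} [Group G] (A : Subgroup G) [A.Normal]
    (K : Subgroup (G ⧸ A)) : A.relIndex (K.comap (QuotientGroup.mk' A)) = Nat.card K := by
  have h := Subgroup.relIndex_ker (K := K.comap (QuotientGroup.mk' A)) (QuotientGroup.mk' A)
  rwa [QuotientGroup.ker_mk',
    Subgroup.map_comap_eq_self_of_surjective (QuotientGroup.mk'_surjective A)] at h

theorem pPrimeCore_quotient_pPrimeCore (p : ℕ) (G : Type*) [Group G] [Finite G] :
    pPrimeCore p (G ⧸ pPrimeCore p G) = ⊥ := by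
  set O := pPrimeCore p G with hO
  have hcard : (Nat.card ((pPrimeCore p (G ⧸ O)).comap (QuotientGroup.mk' O))).Coprime p := by
    rw [← Subgroup.relIndex_bot_left, ← Subgroup.relIndex_mul_relIndex ⊥ O _ bot_le
      (le_comap_mk' O _), Subgroup.relIndex_bot_left, relIndex_comap_mk']
    exact Nat.Coprime.mul_left (card_pPrimeCore_coprime p G) (card_pPrimeCore_coprime p _)
  rw [← Subgroup.map_comap_eq_self_of_surjective (QuotientGroup.mk'_surjective O) (pPrimeCore p _),
    Subgroup.map_eq_bot_iff, QuotientGroup.ker_mk']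
  exact le_pPrimeCore ((pPrimeCore_normal p _).comap _) hcard

theorem IsPSolvableGroup.of_surjective {p : ℕ} [Fact p.Prime] {G Q : Type*} [Group G] [Group Q]
    {f : G →* Q} (hf : Function.Surjective f) (h : IsPSolvableGroup p G) :
    IsPSolvableGroup p Q := by
  obtain ⟨n, H, h0, hn, hnor, hstep⟩ := h
  refine ⟨n, fun i => (H i).map f, by simp [h0], by simp [hn, Subgroup.map_top_of_surjective f hf],
    fun i => (hnor i).map f hf, fun i hi => ⟨Subgroup.map_mono (hstep i hi).1, ?_⟩⟩
  have hdvd : ((H i).map f).relIndex ((H (i + 1)).map f) ∣ (H i).relIndex (H (i + 1)) := by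
    rw [← Subgroup.relIndex_comap]
    exact Subgroup.relIndex_dvd_of_le_left _ (Subgroup.le_comap_map f _)
  rcases (hstep i hi).2 with ⟨k, hk⟩ | hc
  · rw [hk, Nat.dvd_prime_pow Fact.out] at hdvd
    exact Or.inl (hdvd.imp fun _ h => h.2)
  · exact Or.inr (hc.coprime_dvd_left hdvd)

/-- If `O_{p'}(G) = 1`, then a central `p`-subgroup `E` of a normal subgroup `D` with `|D : E|` prime
to `p` is all of `D`. -/
theorem le_of_central_of_coprime_relIndex {p : ℕ} [Fact p.Prime] {G : Type*} [Group G] [Finite G]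
    (hG : pPrimeCore p G = ⊥) {D E : Subgroup G} (hD : D.Normal) (hE : IsPGroup p E) (hED : E ≤ D)
    (hcen : ∀ e ∈ E, ∀ d ∈ D, e * d = d * e) (hidx : (E.relIndex D).Coprime p) : D ≤ E := by
  have hEn : (E.subgroupOf D).Normal :=
    ⟨fun e he d => by
      rw [Subgroup.mem_subgroupOf] at he ⊢
      simpa [← hcen e he d d.2] using he⟩
  obtain ⟨k, hk⟩ := IsPGroup.iff_card.1 hE
  have hcardE : Nat.card (E.subgroupOf D) = p ^ k := by
    rw [← hk]; exact Nat.card_congr (Subgroup.subgroupOfEquivOfLe hED).toEquiv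
  have hcop : (Nat.card (E.subgroupOf D)).Coprime (E.subgroupOf D).index := by
    rw [hcardE]
    exact (hidx.symm).pow_left k
  obtain ⟨K, hK⟩ := Subgroup.exists_right_complement'_of_coprime hcop
  have hKcard : Nat.card K = E.relIndex D := hK.symm.index_eq_card.symm
  set m := Nat.card K with hm
  -- The complement is the solution set of `d ^ m = 1` in `D`, hence stable under conjugation by
  -- `G`.
  have hmem : ∀ d : D, d ∈ K ↔ d ^ m = 1 := by
    intro d
    refine ⟨fun hd => ?_, fun hd => ?_⟩
    · have : (⟨d, hd⟩ : K) ^ m = 1 := pow_card_eq_one'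
      exact congrArg Subtype.val this
    · obtain ⟨⟨e, c⟩, hec⟩ := hK.2 d
      have he : (e : D) ∈ E.subgroupOf D := e.2
      have hcomm : Commute (e : D) (c : D) := Subtype.ext (hcen _ he _ (c : D).2)
      have hcm : (c : D) ^ m = 1 := congrArg Subtype.val (pow_card_eq_one' : c ^ m = 1)
      simp only at hec
      rw [← hec, hcomm.mul_pow, hcm, mul_one] at hd
      have he1 : (⟨(e : D), he⟩ : E.subgroupOf D) = 1 :=
        (IsPGroup.of_card hcardE).eq_one_of_pow_eq_one_of_coprime (n := m)
          (by rw [hKcard]; exact hidx.symm) (Subtype.ext hd)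
      have he2 : (e : D) = 1 := congrArg Subtype.val he1
      rw [← hec, he2, one_mul]
      exact c.2
  have hKn : (K.map D.subtype).Normal := by
    refine ⟨?_⟩
    rintro _ ⟨d, hd, rfl⟩ g
    refine ⟨⟨g * d * g⁻¹, hD.conj_mem d d.2 g⟩, ?_, rfl⟩
    have := congrArg Subtype.val ((hmem d).1 hd)
    refine (hmem _).2 (Subtype.ext ?_)
    rw [SubgroupClass.coe_pow, conj_pow]
    rw [SubgroupClass.coe_pow] at this
    simp [this]
  have hKb : K = ⊥ := by
    have : K.map D.subtype ≤ ⊥ := by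
      rw [← hG]
      refine le_pPrimeCore hKn ?_
      rw [Subgroup.card_map_of_injective D.subtype_injective, ← hm, hKcard]
      exact hidx
    rw [le_bot_iff] at this
    exact (Subgroup.map_eq_bot_iff_of_injective _ D.subtype_injective).1 this
  rw [← Subgroup.relIndex_eq_one, ← hKcard, hm, hKb, Subgroup.card_bot]

/-- The Hall–Higman centralizer lemma. -/
theorem centralizer_pCore_le {p : ℕ} [Fact p.Prime] {G : Type*} [Group G] [Finite G]
    (hG : IsPSolvableGroup p G) (hcore : pPrimeCore p G = ⊥) :
    Subgroup.centralizer (pCore p G : Set G) ≤ pCore p G := by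
  obtain ⟨n, H, h0, hn, hnor, hstep⟩ := hG
  have hV := isPGroup_pCore p G
  have hVn := pCore_normal p G
  set V := pCore p G with hVdef
  set C := Subgroup.centralizer (V : Set G) with hC
  have hCn : C.Normal := Subgroup.normal_centralizer
  -- Climb the series: a `p`-factor keeps `H i ⊓ C` a normal `p`-subgroup, and a `p'`-factor adds
  -- nothing because `H i ⊓ C ≤ V` is centralized by `C`.
  have main : ∀ i ≤ n, H i ⊓ C ≤ V := by
    intro i
    induction i with
    | zero => intro _; rw [h0, bot_inf_eq]; exact bot_le
    | succ i ih =>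
      intro hi
      have hE := ih (by omega)
      have hHn := hnor i
      have hHn' := hnor (i + 1)
      have hEp : IsPGroup p (H i ⊓ C : Subgroup G) := hV.to_le hE
      have hle : H i ⊓ C ≤ H (i + 1) ⊓ C := inf_le_inf_right _ (hstep i hi).1
      have hDn : (H (i + 1) ⊓ C).Normal := inferInstance
      have hdvd : (H i ⊓ C).relIndex (H (i + 1) ⊓ C) ∣ (H i).relIndex (H (i + 1)) := by
        have e : (H i ⊓ C).relIndex (H (i + 1) ⊓ C) = (H i).relIndex (H (i + 1) ⊓ C) := by
          rw [← Subgroup.inf_relIndex_right (H i), ← Subgroup.inf_relIndex_right (H i ⊓ C)]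
          congr 1
          ext; simp only [Subgroup.mem_inf]; tauto
        rw [e]
        have hs : ((H i).subgroupOf (H (i + 1))).Normal := hHn.subgroupOf _
        rw [← Subgroup.relIndex_subgroupOf (inf_le_left : H (i + 1) ⊓ C ≤ H (i + 1))]
        exact Subgroup.relIndex_dvd_index_of_normal _ _
      rcases (hstep i hi).2 with ⟨k, hk⟩ | hc
      · refine le_pCore hDn (IsPGroup.iff_card.2 ?_)
        obtain ⟨a, ha⟩ := IsPGroup.iff_card.1 hEp
        rw [hk, Nat.dvd_prime_pow Fact.out] at hdvd
        obtain ⟨b, -, hb⟩ := hdvd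
        refine ⟨a + b, ?_⟩
        rw [← Subgroup.relIndex_bot_left, ← Subgroup.relIndex_mul_relIndex ⊥ _ _ bot_le hle, hb,
          Subgroup.relIndex_bot_left, ha, pow_add]
      · refine (le_of_central_of_coprime_relIndex hcore hDn hEp hle ?_
          (hc.coprime_dvd_left hdvd)).trans hE
        intro e he d hd
        exact Subgroup.mem_centralizer_iff.1 hd.2 e (hE he)
  simpa [hn] using main n le_rfl

/-! ### Conjugacy of complements and quadratic action. -/

open scoped Pointwise in
theorem isComplement'_conj_of_coprime {G : Type*} [Group G] [Finite G] {H : Subgroup G} [H.Normal]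
    [IsMulCommutative H] (hH : (Nat.card H).Coprime H.index) {K K' : Subgroup G}
    (hK : H.IsComplement' K) (hK' : H.IsComplement' K') :
    ∃ h ∈ H, K.map (MulAut.conj h).toMonoidHom = K' := by
  -- A complement, viewed as a transversal, is fixed by its own translations, so it stabilizes a
  -- point of `H.QuotientDiff`; `H` acts transitively on these points.
  have stab : ∀ {K : Subgroup G}, H.IsComplement' K →
      ∃ α : H.QuotientDiff, MulAction.stabilizer G α = K := by
    intro K hK
    let T : H.LeftTransversal := ⟨K, hK.symm⟩
    let α : H.QuotientDiff := Quotient.mk'' T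
    refine ⟨α, ?_⟩
    have hle : K ≤ MulAction.stabilizer G α := by
      intro k hk
      rw [MulAction.mem_stabilizer_iff]
      have : MulOpposite.op k⁻¹ • T = T := by
        apply Subtype.ext
        change MulOpposite.op k⁻¹ • (K : Set G) = K
        ext x
        rw [Set.mem_smul_set_iff_inv_smul_mem]
        simp [K.mul_mem_cancel_right hk]
      exact congrArg Quotient.mk'' this
    have h2 := Subgroup.isComplement'_stabilizer_of_coprime
      (α := α) hH
    refine (Subgroup.eq_of_le_of_card_ge hle ?_).symm
    rw [← h2.symm.index_eq_card, ← hK.symm.index_eq_card]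
  obtain ⟨α, rfl⟩ := stab hK
  obtain ⟨β, rfl⟩ := stab hK'
  obtain ⟨h, rfl⟩ := Subgroup.exists_smul_eq hH α β
  exact ⟨h, h.2, (MulAction.stabilizer_smul_eq_stabilizer_map_conj (h : G) α).symm⟩

/-- The factor 2 matters for `p = 2`: `2 ∣ n` alone does not make `n.choose 2` even. -/
theorem dvd_choose_two_of_two_mul_dvd {p n : ℕ} (h : 2 * p ∣ n) : p ∣ n.choose 2 := by
  obtain ⟨m, rfl⟩ := h
  rw [Nat.choose_two_right, show 2 * p * m * (2 * p * m - 1) = 2 * (p * (m * (2 * p * m - 1))) by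
    ring, Nat.mul_div_cancel_left _ two_pos]
  exact dvd_mul_right _ _

theorem pow_mul_pow_eq_of_dvd {G : Type*} [Group G] {p n : ℕ} (h : 2 * p ∣ n) {a x : G}
    (ha : a ^ p = 1) (hd : ⁅x, a⁆ ^ p = 1) (hda : Commute ⁅x, a⁆ a) (hdx : Commute ⁅x, a⁆ x) :
    (a * x) ^ n = x ^ n := by
  rw [mul_pow_of_central_commutator (d := ⁅x, a⁆) (by simp only [commutatorElement_def]; group)
    hda hdx]
  obtain ⟨k, hk⟩ := (Dvd.intro_left 2 rfl : p ∣ 2 * p).trans h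
  obtain ⟨j, hj⟩ := dvd_choose_two_of_two_mul_dvd h
  rw [hj, pow_mul ⁅x, a⁆, hd, one_pow, mul_one]
  nth_rewrite 1 [hk]
  rw [pow_mul, ha, one_pow, one_mul]

/-- Let `A` be an elementary abelian normal `p`-subgroup, `L / A` a normal `p'`-subgroup of `G / A`
and suppose that `x ^ n ∈ A`, where `2p ∣ n`, and that `x` acts quadratically on `A`. Then `x ^ n`
centralizes `L`. -/
theorem commute_pow_of_quadratic {p n : ℕ} [Fact p.Prime] {G : Type*} [Group G] [Finite G]
    {A L : Subgroup G} (hA : A.Normal) (hL : L.Normal)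
    (hcomm : ∀ a ∈ A, ∀ b ∈ A, a * b = b * a) (hexp : ∀ a ∈ A, a ^ p = 1)
    (hidx : (A.relIndex L).Coprime p) {x : G} (hn : 2 * p ∣ n) (hx : x ^ n ∈ A)
    (hquad : ∀ a ∈ A, Commute ⁅x, a⁆ x) : ∀ l ∈ L, x ^ n * l = l * x ^ n := by
  set H := A.subgroupOf L with hH
  have hHn : H.Normal := hA.subgroupOf L
  have hHc : IsMulCommutative H :=
    ⟨⟨fun a b => Subtype.ext (Subtype.ext (hcomm _ a.2 _ b.2))⟩⟩
  have hHp : IsPGroup p H := fun a => ⟨1, Subtype.ext (Subtype.ext (by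
    simpa using hexp _ a.2))⟩
  obtain ⟨k, hk⟩ := IsPGroup.iff_card.1 hHp
  have hcop : (Nat.card H).Coprime H.index := by
    rw [hk]
    exact hidx.symm.pow_left k
  obtain ⟨K, hK⟩ := Subgroup.exists_right_complement'_of_coprime hcop
  let φ : MulAut L := MulAut.conjNormal x
  have hKcard : Nat.card (K.map φ.toMonoidHom) = Nat.card K :=
    Subgroup.card_map_of_injective φ.injective
  have hK' : H.IsComplement' (K.map φ.toMonoidHom) := by
    refine Subgroup.isComplement'_of_coprime ?_ ?_
    · rw [hKcard, ← hK.symm.index_eq_card, H.card_mul_index]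
    · rwa [hKcard, ← hK.symm.index_eq_card]
  obtain ⟨h, hhH, hh⟩ := isComplement'_conj_of_coprime hcop hK hK'
  -- As `x` carries `K` to its conjugate by `h`, the element `h⁻¹ * x` normalizes `K`.
  have haA : ((h⁻¹ : L) : G) ∈ A := H.inv_mem hhH
  set a : G := ((h⁻¹ : L) : G) with ha
  have hdA : ⁅x, a⁆ ∈ A := A.mul_mem (hA.conj_mem a haA x) (A.inv_mem haA)
  have hy : (a * x) ^ n = x ^ n :=
    pow_mul_pow_eq_of_dvd hn (hexp a haA) (hexp _ hdA) (hcomm _ hdA _ haA) (hquad a haA)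
  have hnorm : ∀ c ∈ K, MulAut.conjNormal (a * x) c ∈ K := by
    intro c hc
    have : φ c ∈ K.map (MulAut.conj h).toMonoidHom := hh ▸ Subgroup.mem_map_of_mem _ hc
    obtain ⟨c', hc', e⟩ := this
    have e' : MulAut.conjNormal (a * x) c = c' := by
      apply Subtype.ext
      have e2 := congrArg Subtype.val e
      simp only [MulEquiv.toMonoidHom_eq_coe, MonoidHom.coe_coe, MulAut.conj_apply,
        Subgroup.coe_mul, InvMemClass.coe_inv, φ, MulAut.conjNormal_apply] at e2
      rw [MulAut.conjNormal_apply, ha, InvMemClass.coe_inv, mul_inv_rev, inv_inv]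
      calc (h : G)⁻¹ * x * c * (x⁻¹ * h) = (h : G)⁻¹ * (x * c * x⁻¹) * h := by group
        _ = c' := by rw [← e2]; group
    rw [e']
    exact hc'
  have hnorm' : ∀ (m : ℕ), ∀ c ∈ K, MulAut.conjNormal ((a * x) ^ m) c ∈ K := by
    intro m
    induction m with
    | zero => intro c hc; simpa using hc
    | succ m ih =>
      intro c hc
      rw [pow_succ, map_mul, MulAut.mul_apply]
      exact ih _ (hnorm c hc)
  have hKc : ∀ c ∈ K, x ^ n * (c : G) = c * x ^ n := by
    intro c hc
    have h1 : MulAut.conjNormal (x ^ n) c * c⁻¹ ∈ K :=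
      K.mul_mem (hy ▸ hnorm' n c hc) (K.inv_mem hc)
    have h2 : MulAut.conjNormal (x ^ n) c * c⁻¹ ∈ H := by
      rw [hH, Subgroup.mem_subgroupOf, Subgroup.coe_mul, MulAut.conjNormal_apply, mul_assoc,
        mul_assoc, ← mul_assoc (c : G)]
      exact A.mul_mem hx (hA.conj_mem _ (A.inv_mem hx) c)
    have h3 : MulAut.conjNormal (x ^ n) c * c⁻¹ = 1 := by
      exact Subgroup.disjoint_def.1 hK.disjoint h2 h1
    have h4 := congrArg Subtype.val (mul_inv_eq_one.1 h3)
    rw [MulAut.conjNormal_apply] at h4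
    exact mul_inv_eq_iff_eq_mul.1 h4
  intro l hl
  obtain ⟨⟨b, c⟩, hbc⟩ := hK.2 ⟨l, hl⟩
  have e : l = ((b : L) : G) * ((c : L) : G) := (congrArg Subtype.val hbc).symm
  have hb : x ^ n * ((b : L) : G) = ((b : L) : G) * x ^ n := hcomm _ hx _ b.2
  rw [e, ← mul_assoc, hb, mul_assoc, hKc c c.2, mul_assoc]

theorem pPrimeCore_quotient_normalClosure {p n : ℕ} [Fact p.Prime] {G : Type*} [Group G] [Finite G]
    (hcore : pPrimeCore p G = ⊥) {V : Subgroup G} (hV : V.Normal)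
    (hVp : IsPGroup p V) {x : G} (hn : 2 * p ∣ n) (hxV : x ^ n ∈ V)
    (hxc : ∀ v ∈ V, Commute (x ^ n) v) (hxp : (x ^ n) ^ p = 1)
    (hquad : ∀ v ∈ V, Commute ⁅x, v⁆ x) :
    pPrimeCore p (G ⧸ Subgroup.normalClosure {x ^ n}) = ⊥ := by
  set A := Subgroup.normalClosure {x ^ n} with hA
  have hAn : A.Normal := Subgroup.normalClosure_normal
  have hAV : A ≤ V := Subgroup.normalClosure_le_normal (by simpa using hxV)
  have hxA : x ^ n ∈ A := Subgroup.subset_normalClosure rfl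
  have hAC : A ≤ Subgroup.centralizer (V : Set G) := by
    have : (Subgroup.centralizer (V : Set G)).Normal := Subgroup.normal_centralizer
    refine Subgroup.normalClosure_le_normal ?_
    rw [Set.singleton_subset_iff, SetLike.mem_coe, Subgroup.mem_centralizer_iff]
    exact fun v hv => (hxc v hv).symm
  have hcomm : ∀ a ∈ A, ∀ b ∈ A, a * b = b * a := fun a ha b hb =>
    Subgroup.mem_centralizer_iff.1 (hAC hb) a (hAV ha)
  have hexp : ∀ a ∈ A, a ^ p = 1 := by
    intro a ha
    refine Subgroup.closure_induction (p := fun a _ => a ^ p = 1) ?_ (one_pow p) ?_ ?_ ha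
    · intro b hb
      obtain ⟨_, rfl, hb⟩ := Group.mem_conjugatesOfSet_iff.1 hb
      obtain ⟨g, rfl⟩ := isConj_iff.1 hb
      rw [conj_pow, hxp, mul_one, mul_inv_cancel]
    · intro b c hb hc ihb ihc
      rw [Commute.mul_pow (hcomm b hb c hc), ihb, ihc, one_mul]
    · intro b _ ihb
      rw [inv_pow, ihb, inv_one]
  set L := (pPrimeCore p (G ⧸ A)).comap (QuotientGroup.mk' A) with hLdef
  have hLn : L.Normal := (pPrimeCore_normal p _).comap _
  have hAL : A ≤ L := le_comap_mk' A _
  have hidx : (A.relIndex L).Coprime p := by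
    rw [hLdef, relIndex_comap_mk']
    exact card_pPrimeCore_coprime p _
  have hxL := commute_pow_of_quadratic hAn hLn hcomm hexp hidx hn hxA
    (fun a ha => hquad a (hAV ha))
  have hALc : A ≤ Subgroup.centralizer (L : Set G) := by
    have : (Subgroup.centralizer (L : Set G)).Normal := Subgroup.normal_centralizer
    refine Subgroup.normalClosure_le_normal ?_
    rw [Set.singleton_subset_iff, SetLike.mem_coe, Subgroup.mem_centralizer_iff]
    exact fun l hl => (hxL l hl).symm
  have hLA : L ≤ A := le_of_central_of_coprime_relIndex hcore hLn (hVp.to_le hAV) hAL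
    (fun a ha l hl => (Subgroup.mem_centralizer_iff.1 (hALc ha) l hl).symm) hidx
  rw [← Subgroup.map_comap_eq_self_of_surjective (QuotientGroup.mk'_surjective A) (pPrimeCore p _),
    Subgroup.map_eq_bot_iff, QuotientGroup.ker_mk']
  exact hLA

/-! ### Induction on the group order and conclusion. -/

/-- Taking `S` as a plain subgroup lets the induction hypothesis apply directly to the image `P.map
f`. -/
theorem map_subtype_le_pCore_of_pPrimeCore_eq_bot (p : ℕ) [Fact p.Prime] (G : Type*) [Group G]
    [Finite G] (hG : IsPSolvableGroup p G) (hcore : pPrimeCore p G = ⊥) (S : Subgroup G)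
    (hS : ∃ P : Sylow p G, (P : Subgroup G) = S) (N : Subgroup S)
    (hN : IsPowerfullyEmbedded p N) : N.map S.subtype ≤ pCore p G := by
  induction hm : Nat.card G using Nat.strong_induction_on generalizing G with
  | _ m ih =>
  obtain ⟨P, rfl⟩ := hS
  have hV := isPGroup_pCore p G
  have hVn := pCore_normal p G
  have hVP : pCore p G ≤ P := hV.le_sylow_of_normal P
  have hcenter : ∀ z ∈ Subgroup.center (P : Subgroup G), ∀ v ∈ pCore p G,
      Commute (z : G) v := fun z hz v hv =>
    (congrArg Subtype.val (Subgroup.mem_center_iff.1 hz ⟨v, hVP hv⟩)).symm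
  have hcenterV : ∀ z ∈ Subgroup.center (P : Subgroup G), (z : G) ∈ pCore p G := fun z hz =>
    centralizer_pCore_le hG hcore
      (Subgroup.mem_centralizer_iff.2 fun v hv => (hcenter z hz v hv).symm)
  by_cases hc : N ≤ Subgroup.center (P : Subgroup G)
  · rintro _ ⟨z, hz, rfl⟩
    exact hcenterV z (hc hz)
  obtain ⟨x, n, hn, hxP, hxc, hx1, hxp⟩ := hN.exists_pow_mem_center P.isPGroup' hc
  have hxV : (x : G) ^ n ∈ pCore p G := hcenterV _ hxc
  have hquot := pPrimeCore_quotient_normalClosure (x := (x : G)) hcore hVn hV hn hxV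
    (hcenter _ hxc) (congrArg Subtype.val hxp)
    (fun v hv => (congrArg Subtype.val (Subgroup.mem_center_iff.1 (hxP ⟨v, hVP hv⟩) x)).symm)
  set A := Subgroup.normalClosure {(x : G) ^ n} with hA
  have hAV : A ≤ pCore p G := Subgroup.normalClosure_le_normal (by simpa using hxV)
  have hAb : A ≠ ⊥ := by
    intro h
    have : (x : G) ^ n ∈ A := Subgroup.subset_normalClosure rfl
    rw [h, Subgroup.mem_bot] at this
    exact hx1 (Subtype.ext this)
  have hAp := hV.to_le hAV
  have hlt : Nat.card (G ⧸ A) < m := by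
    rw [← hm, ← A.card_mul_index, ← Subgroup.index_eq_card]
    exact lt_mul_of_one_lt_left (Nat.pos_of_ne_zero Subgroup.index_ne_zero_of_finite)
      (A.one_lt_card_iff_ne_bot.2 hAb)
  let f := QuotientGroup.mk' A
  have hf : Function.Surjective f := QuotientGroup.mk'_surjective A
  have key := ih _ hlt (G ⧸ A) (hG.of_surjective hf) hquot ((P : Subgroup G).map f)
    ⟨P.mapSurjective hf, P.coe_mapSurjective hf⟩ (N.map (f.subgroupMap P))
    (hN.map (f.subgroupMap_surjective P)) rfl
  have hle : N.map (P : Subgroup G).subtype ≤ (pCore p (G ⧸ A)).comap f := by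
    rintro _ ⟨z, hz, rfl⟩
    exact key ⟨f.subgroupMap P z, Subgroup.mem_map_of_mem _ hz, rfl⟩
  -- The preimage is a `p`-group because both `O_p(G / A)` and the kernel `A ≤ V` are.
  refine hle.trans (le_pCore ((pCore_normal p _).comap f) ?_)
  refine (isPGroup_pCore p (G ⧸ A)).comap_of_ker_isPGroup f ?_
  rwa [QuotientGroup.ker_mk']

theorem proposition4p2 (p : ℕ) [Fact p.Prime] (G : Type*) [Group G] [Finite G]
    (hG : IsPSolvableGroup p G) (P : Sylow p G) (N : Subgroup (P : Subgroup G))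
    (hN : IsPowerfullyEmbedded p N) :
    N.map (P : Subgroup G).subtype ≤ pPrimePCore p G := by
  let f := QuotientGroup.mk' (pPrimeCore p G)
  have hf : Function.Surjective f := QuotientGroup.mk'_surjective _
  have key := map_subtype_le_pCore_of_pPrimeCore_eq_bot p (G ⧸ pPrimeCore p G)
    (hG.of_surjective hf) (pPrimeCore_quotient_pPrimeCore p G) ((P : Subgroup G).map f)
    ⟨P.mapSurjective hf, P.coe_mapSurjective hf⟩ (N.map (f.subgroupMap P))
    (hN.map (f.subgroupMap_surjective P))
  rintro _ ⟨z, hz, rfl⟩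
  exact key ⟨f.subgroupMap P z, Subgroup.mem_map_of_mem _ hz, rfl⟩
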